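/- Let $\alpha>0$, $w<0$, let $(a_k)_{k\ge 0}$ be complex numbers with $\sum_k|a_k|<\infty$ and let $b_k\ge 0$ for every $k\ge 0$. Put $P(t)=\sum_{k=0}^{\infty}a_ke^{2\pi i b_kt}$ and $g(t)=\dfrac{P(t)}{t-iw}$ for $t\in\mathbb{R}$. For $b\in[0,1/\alpha)$ let $L_b$ be the circular shift on $L^2(0,1/\alpha)$, $$L_bf(x)=\begin{cases} f(x-b), & x\in[b,1/\alpha),\\ f(x-b+1/\alpha), & x\in(0,b),\end{cases}$$ let $M_\varphi$ denote multiplication by $\varphi$, let $b_k^{*}\in[0,1/\alpha)$ be $b_k$ reduced modulo $1/\alpha$, and define on $L^2(0,1/\alpha)$ the operator $$A_k=M_{e^{-2\pi wt}}\,L_{b_k^{*}}\,M_{e^{2\pi wt}}.$$ For $G\in L^2(\mathbb{R})$, $m\in\mathbb{Z}$ let $A_kG(t+m+b_k)$ denote $A_k$ applied to the restriction of $t\mapsto G(t+m+b_k)$ to $(0,1/\alpha)$. Then for every $G\in L^2(\mathbb{R})$ and $m\in\mathbb{Z}$ the series $\sum_k a_kA_kG(t+m+b_k)$ converges absolutely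 for almost every $t\in(0,1/\alpha)$, and the following are equivalent: 1. The Gabor system $\mathcal{G}(g;\alpha,1)=\{e^{2\pi imt}g(t-\alpha n)\}_{m,n\in\mathbb{Z}}$ is a frame in $L^2(\mathbb{R})$, i.e. $g\in L^2(\mathbb{R})$ and there are constants $A,B>0$ such that $A\|f\|_2^2\le\sum_{m,n\in\mathbb{Z}}\left|\int_{\mathbb{R}}f(t)\,\overline{e^{2\pi imt}g(t-\alpha n)}\,dt\right|^2\le B\|f\|_2^2$ for all $f\in L^2(\mathbb{R})$. 2. $$\sum_{m\in\mathbb{Z}}\int_0^{1/\alpha}\Bigl|\sum_{k=0}^{\infty}a_kA_kG(t+m+b_k)\Bigr|^2dt\asymp\|G\|_2^2\quad\text{for all }G\in L^2(\mathbb{R}),$$ that is, each side is at most a finite constant, independent of $G$, times the other. -/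

import Mathlib

open MeasureTheory Set
open scoped ENNReal NNReal ComplexConjugate

noncomputable section

namespace GaborCauchy

/-- The time-frequency shift `π_{x,ω} g (t) = e^{2π i ω t} g (t - x)`. -/
def timeFreqShift (x ω : ℝ) (g : ℝ → ℂ) : ℝ → ℂ :=
  fun t => Complex.exp (2 * Real.pi * Complex.I * ω * t) * g (t - x)

/-- The Gabor system `{π_{α n, β m} g}` with window `g` over the lattice `αℤ × βℤ`,
indexed by the pairs `(m, n)`. -/
def gaborSystem (g : ℝ → ℂ) (α β : ℝ) : ℤ × ℤ → ℝ → ℂ :=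
  fun mn => timeFreqShift (α * mn.2) (β * mn.1) g

/-- The inner product `(f, h) = ∫ f(t) conj(h(t)) dt` of two square integrable functions. -/
def innerL2 (f h : ℝ → ℂ) : ℂ := ∫ t, f t * conj (h t)

/-- The squared `L²(ℝ)` norm, as an extended nonnegative real. -/
def normSqL2 (f : ℝ → ℂ) : ℝ≥0∞ := eLpNorm f 2 volume ^ 2

/-- `𝒢(g; α, β)` is a frame in `L²(ℝ)`: the window is in `L²(ℝ)` and the frame inequality
`A ‖f‖² ≤ ∑_{m,n} |(f, π_{α n, β m} g)|² ≤ B ‖f‖²` holds for all `f ∈ L²(ℝ)`, with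
constants `A, B > 0`. The sum is taken in `[0, ∞]`, so its finiteness is part of the claim. -/
def IsGaborFrame (g : ℝ → ℂ) (α β : ℝ) : Prop :=
  MemLp g 2 volume ∧
    ∃ A B : ℝ≥0, 0 < A ∧ 0 < B ∧ ∀ f : ℝ → ℂ, MemLp f 2 volume →
      A * normSqL2 f ≤ ∑' mn : ℤ × ℤ, ‖innerL2 f (gaborSystem g α β mn)‖ₑ ^ 2 ∧
      ∑' mn : ℤ × ℤ, ‖innerL2 f (gaborSystem g α β mn)‖ₑ ^ 2 ≤ B * normSqL2 f

/-- The representative of `b` modulo `p` in `[0, p)` (for `p > 0`). -/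
def modPeriod (p b : ℝ) : ℝ := p * Int.fract (b / p)

/-- The circular shift `L_b` on functions on `(0, p)`, for `b ∈ [0, p)`. The value of
`circularShift p b f` at a point of `(0, p)` involves only values of `f` on `[0, p]`. -/
def circularShift (p b : ℝ) (f : ℝ → ℂ) : ℝ → ℂ :=
  fun x => if b ≤ x then f (x - b) else f (x - b + p)

/-- The multiplication operator `M_φ`. -/
def mulOp (φ f : ℝ → ℂ) : ℝ → ℂ := fun x => φ x * f x

/-- The weighted circular shift `M_{e^{-2πwt}} L_{b*} M_{e^{2πwt}}` on functions on `(0, p)`,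
where `b* = b mod p`. -/
def weightedShift (p w b : ℝ) (f : ℝ → ℂ) : ℝ → ℂ :=
  mulOp (fun t => (Real.exp (-2 * Real.pi * w * t) : ℂ))
    (circularShift p (modPeriod p b)
      (mulOp (fun t => (Real.exp (2 * Real.pi * w * t) : ℂ)) f))

/-- The weighted circular shift is well defined on classes of functions on `(0, p)` modulo
equality almost everywhere. -/
theorem weightedShift_congr_ae {p : ℝ} (hp : 0 < p) (w b : ℝ) {f₁ f₂ : ℝ → ℂ}
    (h : f₁ =ᵐ[volume.restrict (Ioc 0 p)] f₂) :
    weightedShift p w b f₁ =ᵐ[volume.restrict (Ioc 0 p)] weightedShift p w b f₂ := by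
  have hc0 : 0 ≤ modPeriod p b := mul_nonneg hp.le (Int.fract_nonneg _)
  have hcp : modPeriod p b < p := by
    have := mul_lt_mul_of_pos_left (Int.fract_lt_one (b / p)) hp
    simpa [modPeriod] using this
  unfold weightedShift
  generalize modPeriod p b = c at hc0 hcp ⊢
  rw [Filter.EventuallyEq, ae_restrict_iff' measurableSet_Ioc] at h ⊢
  have h1 := (measurePreserving_sub_right (volume : Measure ℝ) c).quasiMeasurePreserving.ae h
  have h2 := (measurePreserving_sub_right (volume : Measure ℝ) (c - p)).quasiMeasurePreserving.ae h
  have h3 : ∀ᵐ x : ℝ, x ≠ c := by simp [ae_iff]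
  filter_upwards [h1, h2, h3] with x hx1 hx2 hx3 hx
  simp only [mulOp, circularShift]
  split_ifs with hcx
  · have hlt : c < x := lt_of_le_of_ne hcx (Ne.symm hx3)
    rw [hx1 ⟨by linarith, by linarith [hx.2]⟩]
  · have e : x - (c - p) = x - c + p := by ring
    rw [e] at hx2
    rw [hx2 ⟨by linarith [hx.1], by linarith⟩]

/-- The generalized trigonometric series `P(t) = ∑_k a_k e^{2π i b_k t}`. -/
def trigSeries (a : ℕ → ℂ) (b : ℕ → ℝ) (t : ℝ) : ℂ :=
  ∑' k, a k * Complex.exp (2 * Real.pi * Complex.I * b k * t)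

/-- The window `g(t) = P(t) / (t - i w)`. -/
def window (a : ℕ → ℂ) (b : ℕ → ℝ) (w : ℝ) (t : ℝ) : ℂ :=
  trigSeries a b t / (t - Complex.I * w)

/-- The `k`-th term `a_k A_k G(t + m + b_k)`, where `A_k` is applied to the function
`t ↦ G(t + m + b_k)` on `(0, 1/α)`. -/
def shiftTerm (a : ℕ → ℂ) (b : ℕ → ℝ) (w α : ℝ) (G : ℝ → ℂ) (m : ℤ) (k : ℕ) (t : ℝ) : ℂ :=
  a k * weightedShift (1 / α) w (b k) (fun s => G (s + m + b k)) t

/-- `∑_{m ∈ ℤ} ∫_0^{1/α} |∑_k a_k A_k G(t + m + b_k)|² dt`, with values in `[0, ∞]`. -/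
def shiftEnergy (a : ℕ → ℂ) (b : ℕ → ℝ) (w α : ℝ) (G : ℝ → ℂ) : ℝ≥0∞ :=
  ∑' m : ℤ, ∫⁻ t in Ioc 0 (1 / α), ‖∑' k, shiftTerm a b w α G m k t‖ₑ ^ 2

/-- `U(z) ≲ V(z)` on the set `S`: `U ≤ C V` on `S` with a finite constant `C`. -/
def LessSimOn {X : Type*} (S : Set X) (U V : X → ℝ≥0∞) : Prop :=
  ∃ C : ℝ≥0, ∀ z ∈ S, U z ≤ C * V z

/-- `U(z) ≍ V(z)` on the set `S`. -/
def AsympOn {X : Type*} (S : Set X) (U V : X → ℝ≥0∞) : Prop :=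
  LessSimOn S U V ∧ LessSimOn S V U

end GaborCauchy

end

/-! Write p = 1/α and q = e^{2πwp} < 1. The window is a superposition of Cauchy kernels, so each
Gabor atom is an absolutely convergent combination, with phases e^{-2πiαn b_k}, of
e^{2πi(m+b_k)t}/(t - αn - iw). The Fourier transform of such a kernel is a decaying exponential on a
half-line (`integral_cauchyAtomHat_mul_exp`).

Parametrize f by G through 𝓕f = conj(G - q G(· + p)). Moving the shift from G to the exponential
truncates the half-line to one interval of length p, because e^{2πiαnp} = 1
(`cauchyAtomHat_sub_shift`). Hence the pairing of f with a kernel is, up to 2πi and conjugation, the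
n-th Fourier integral over (0, p] of e^{2πws} G(s + m + b_k) (`integral_mul_conj_cauchyAtomHat`),
and the phase becomes a circular shift by b_k mod p (`exp_mul_integral_weightedTranslate`).

Summing over k and using Parseval in n for each m turns the frame sum into a constant times the
shift energy without its outer weight e^{-2πwt} (`tsum_enorm_innerL2_gaborSystem_sq`). That weight
is bounded above and below on (0, p]. Since q < 1, the map from G to G - q G(· + p) is an
isomorphism of L², so f and G range over all of L² with comparable norms, and the two inequalities
translate into each other. -/

noncomputable section

namespace GaborCauchy

/-! ### Series of functions with summable L² bounds on a finite measure space -/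

section SeriesL2

variable {X : Type*} [MeasurableSpace X] {μ : Measure X} {v : ℕ → X → ℂ} {C : ℕ → ℝ≥0}

/-- On a finite measure space Hölder bounds the L¹ norm by a constant multiple of the L² norm. -/
theorem tsum_lintegral_enorm_lt_top [IsFiniteMeasure μ] (hC : Summable C)
    (hv : ∀ k, AEStronglyMeasurable (v k) μ) (hvC : ∀ k, eLpNorm (v k) 2 μ ≤ C k) :
    ∑' k, ∫⁻ x, ‖v k x‖ₑ ∂μ < ∞ := by
  have key : ∀ k, ∫⁻ x, ‖v k x‖ₑ ∂μ ≤
      C k * μ univ ^ (1 / (1 : ℝ≥0∞).toReal - 1 / (2 : ℝ≥0∞).toReal) := by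
    intro k
    rw [← eLpNorm_one_eq_lintegral_enorm]
    refine (eLpNorm_le_eLpNorm_mul_rpow_measure_univ (q := 2) (by norm_num) (hv k)).trans ?_
    gcongr
    exact hvC k
  refine (ENNReal.tsum_le_tsum key).trans_lt ?_
  rw [ENNReal.tsum_mul_right]
  refine ENNReal.mul_lt_top ?_ (ENNReal.rpow_lt_top_of_nonneg (by norm_num) (measure_ne_top _ _))
  exact (ENNReal.tsum_coe_ne_top_iff_summable.2 hC).lt_top

theorem ae_summable_norm_of_eLpNorm_le [IsFiniteMeasure μ] (hC : Summable C)
    (hv : ∀ k, AEStronglyMeasurable (v k) μ) (hvC : ∀ k, eLpNorm (v k) 2 μ ≤ C k) :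
    ∀ᵐ x ∂μ, Summable fun k => ‖v k x‖ := by
  have h := tsum_lintegral_enorm_lt_top hC hv hvC
  rw [← lintegral_tsum fun k => (hv k).enorm] at h
  filter_upwards [ae_lt_top' (AEMeasurable.tsum fun k => (hv k).enorm) h.ne] with x hx
  have := ENNReal.tsum_coe_ne_top_iff_summable.1 hx.ne
  exact NNReal.summable_coe.2 this

theorem summable_integral_norm_of_eLpNorm_le [IsFiniteMeasure μ] (hC : Summable C)
    (hv : ∀ k, AEStronglyMeasurable (v k) μ) (hvC : ∀ k, eLpNorm (v k) 2 μ ≤ C k) :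
    Summable fun k => ∫ x, ‖v k x‖ ∂μ := by
  have h := tsum_lintegral_enorm_lt_top hC hv hvC
  simp_rw [integral_norm_eq_lintegral_enorm (hv _)]
  exact ENNReal.summable_toReal h.ne

/-- Minkowski bounds all partial sums in L² by the total of the `C k`, and Fatou passes this bound
to the almost everywhere limit. -/
theorem memLp_two_tsum [IsFiniteMeasure μ] (hC : Summable C)
    (hv : ∀ k, AEStronglyMeasurable (v k) μ) (hvC : ∀ k, eLpNorm (v k) 2 μ ≤ C k) :
    MemLp (fun x => ∑' k, v k x) 2 μ := by
  have hlim : ∀ᵐ x ∂μ, Filter.Tendsto (fun n => ∑ k ∈ Finset.range n, v k x) Filter.atTop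
      (nhds (∑' k, v k x)) := by
    filter_upwards [ae_summable_norm_of_eLpNorm_le hC hv hvC] with x hx
    exact hx.of_norm.hasSum.tendsto_sum_nat
  have hm : ∀ n, AEStronglyMeasurable (fun x => ∑ k ∈ Finset.range n, v k x) μ := fun n =>
    Finset.aestronglyMeasurable_fun_sum _ fun k _ => hv k
  have hle : eLpNorm (fun x => ∑' k, v k x) 2 μ ≤ ∑' k, (C k : ℝ≥0∞) := by
    refine (Lp.eLpNorm_lim_le_liminf_eLpNorm hm _ hlim).trans ?_
    refine Filter.liminf_le_of_le (by isBoundedDefault) fun c hc => ?_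
    obtain ⟨n, hn⟩ := hc.exists
    refine hn.trans (le_trans ?_ (ENNReal.sum_le_tsum (Finset.range n)))
    have := eLpNorm_sum_le (μ := μ) (p := 2) (f := v) (s := Finset.range n) (fun k _ => hv k)
      (by norm_num)
    have e : (fun x => ∑ k ∈ Finset.range n, v k x) = ∑ k ∈ Finset.range n, v k := by
      ext x; simp
    rw [e]
    exact this.trans (Finset.sum_le_sum fun k _ => hvC k)
  exact ⟨aestronglyMeasurable_of_tendsto_ae _ hm hlim, hle.trans_lt
    (ENNReal.tsum_coe_ne_top_iff_summable.2 hC).lt_top⟩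

end SeriesL2

/-! ### The circular shift as a measure preserving map -/

section CircularShift

/-- The map `x ↦ x - c` modulo `p` on `(0, p]`. -/
def circularMap (p c x : ℝ) : ℝ := if c ≤ x then x - c else x - c + p

theorem measurable_circularMap (p c : ℝ) : Measurable (circularMap p c) :=
  Measurable.ite measurableSet_Ici (by fun_prop) (by fun_prop)

theorem circularShift_eq_comp (p c : ℝ) (f : ℝ → ℂ) :
    circularShift p c f = f ∘ circularMap p c := by
  ext x
  simp only [circularShift, circularMap, Function.comp]
  split_ifs <;> rfl

/-- The map exchanges two adjacent subintervals, acting on each by a translation. -/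
theorem measurePreserving_circularMap {p c : ℝ} (hc : 0 ≤ c) (hcp : c < p) :
    MeasurePreserving (circularMap p c) (volume.restrict (Ioc 0 p))
      (volume.restrict (Ioc 0 p)) := by
  refine ⟨measurable_circularMap p c, ?_⟩
  -- The null point c is dropped: it falls in the branch c ≤ x and is sent to 0, outside (0, p].
  have e1 : volume.restrict (Ioc 0 p) =
      volume.restrict (Ioo 0 c) + volume.restrict (Ioc c p) := by
    rw [← Ioc_union_Ioc_eq_Ioc hc hcp.le, Measure.restrict_union (by simp) measurableSet_Ioc,
      restrict_Ioo_eq_restrict_Ioc]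
  have e2 : volume.restrict (Ioc 0 p) =
      volume.restrict (Ioo (p - c) p) + volume.restrict (Ioc 0 (p - c)) := by
    rw [← Ioc_union_Ioc_eq_Ioc (sub_nonneg.2 hcp.le) (by linarith : p - c ≤ p),
      Measure.restrict_union (by simp) measurableSet_Ioc, restrict_Ioo_eq_restrict_Ioc, add_comm]
  have m1 : Measure.map (circularMap p c) (volume.restrict (Ioo 0 c)) =
      volume.restrict (Ioo (p - c) p) := by
    have h := (measurePreserving_sub_right (volume : Measure ℝ) (c - p)).restrict_preimage
      (s := Ioo (p - c) p) measurableSet_Ioo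
    have hs : (fun x => x - (c - p)) ⁻¹' Ioo (p - c) p = Ioo 0 c := by
      ext x; simp only [mem_preimage, mem_Ioo]; constructor <;> rintro ⟨_, _⟩ <;>
        constructor <;> linarith
    rw [hs] at h
    rw [← h.map_eq]
    refine Measure.map_congr ?_
    filter_upwards [ae_restrict_mem measurableSet_Ioo] with x hx
    rw [circularMap, if_neg (not_le.2 hx.2)]; ring
  have m2 : Measure.map (circularMap p c) (volume.restrict (Ioc c p)) =
      volume.restrict (Ioc 0 (p - c)) := by
    have h := (measurePreserving_sub_right (volume : Measure ℝ) c).restrict_preimage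
      (s := Ioc 0 (p - c)) measurableSet_Ioc
    have hs : (fun x => x - c) ⁻¹' Ioc 0 (p - c) = Ioc c p := by
      ext x; simp
    rw [hs] at h
    rw [← h.map_eq]
    refine Measure.map_congr ?_
    filter_upwards [ae_restrict_mem measurableSet_Ioc] with x hx
    rw [circularMap, if_pos hx.1.le]
  conv_lhs => rw [e1]
  rw [Measure.map_add _ _ (measurable_circularMap p c), m1, m2, ← e2]

theorem modPeriod_nonneg {p : ℝ} (hp : 0 < p) (b : ℝ) : 0 ≤ modPeriod p b :=
  mul_nonneg hp.le (Int.fract_nonneg _)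

theorem modPeriod_lt {p : ℝ} (hp : 0 < p) (b : ℝ) : modPeriod p b < p := by
  have := mul_lt_mul_of_pos_left (Int.fract_lt_one (b / p)) hp
  simpa [modPeriod] using this

/-- A p-periodic exponential thus cannot distinguish the circular shift from the translation by b.
-/
theorem exists_int_circularMap_modPeriod {p : ℝ} (hp : 0 < p) (b x : ℝ) :
    ∃ j : ℤ, circularMap p (modPeriod p b) x = x - b + j * p := by
  have h : modPeriod p b = b - p * ⌊b / p⌋ := by
    rw [modPeriod, Int.fract]; field_simp
  rw [circularMap, h]
  split_ifs
  · exact ⟨⌊b / p⌋, by ring⟩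
  · exact ⟨⌊b / p⌋ + 1, by push_cast; ring⟩

end CircularShift

/-! ### Parseval on (0, p] -/

/-- The squares of the Fourier coefficients of a square integrable function on `(0, p]`. -/
theorem tsum_enorm_integral_exp_sq {p : ℝ} (hp : 0 < p) {T : ℝ → ℂ}
    (hT : MemLp T 2 (volume.restrict (Ioc 0 p))) :
    ∑' n : ℤ, ‖∫ t in Ioc 0 p, T t * Complex.exp (-(2 * Real.pi * Complex.I * n * t / p))‖ₑ ^ 2 =
      ENNReal.ofReal p * ∫⁻ t in Ioc 0 p, ‖T t‖ₑ ^ 2 := by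
  have h := hasSum_sq_fourierCoeffOn hp hT
  have hc : ∀ n : ℤ, ∫ t in Ioc 0 p, T t * Complex.exp (-(2 * Real.pi * Complex.I * n * t / p)) =
      p * fourierCoeffOn hp T n := by
    intro n
    rw [fourierCoeffOn_eq_integral, sub_zero, intervalIntegral.integral_of_le hp.le]
    simp only [one_div, Complex.real_smul, Complex.ofReal_inv]
    rw [mul_inv_cancel_left₀ (by exact_mod_cast hp.ne')]
    refine integral_congr_ae (Filter.Eventually.of_forall fun t => ?_)
    simp only [fourier_coe_apply, smul_eq_mul]
    rw [mul_comm]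
    push_cast
    ring_nf
  have hint : Integrable (fun t => ‖T t‖ ^ 2) (volume.restrict (Ioc 0 p)) :=
    (memLp_two_iff_integrable_sq_norm hT.1).1 hT
  have e : ∫⁻ t in Ioc 0 p, ‖T t‖ₑ ^ 2 = ENNReal.ofReal (∫ t in Ioc 0 p, ‖T t‖ ^ 2) := by
    rw [ofReal_integral_eq_lintegral_ofReal hint (Filter.Eventually.of_forall fun t => by positivity)]
    refine lintegral_congr fun t => ?_
    rw [ENNReal.ofReal_pow (norm_nonneg _), ofReal_norm]
  -- The integrals here are p times the normalized coefficients, and Parseval carries 1/p, so p² ·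
  -- (1/p) = p remains.
  have h2 := h.mul_left (p ^ 2)
  have hterm : ∀ n : ℤ, ‖∫ t in Ioc 0 p,
      T t * Complex.exp (-(2 * Real.pi * Complex.I * n * t / p))‖ₑ ^ 2 =
      ENNReal.ofReal (p ^ 2 * ‖fourierCoeffOn hp T n‖ ^ 2) := by
    intro n
    rw [hc, ← ofReal_norm, ← ENNReal.ofReal_pow (norm_nonneg _), norm_mul, Complex.norm_real,
      Real.norm_of_nonneg hp.le, mul_pow]
  simp_rw [hterm]
  rw [← ENNReal.ofReal_tsum_of_nonneg (fun n => by positivity) h2.summable, h2.tsum_eq, e,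
    ← ENNReal.ofReal_mul hp.le, intervalIntegral.integral_of_le hp.le, sub_zero, smul_eq_mul]
  congr 1
  field_simp

/-! ### Plancherel pairing against a function given by an inverse Fourier integral -/

section Plancherel

open scoped FourierTransform SchwartzMap

/-- This is the Fubini multiplication formula: the transform moves from one factor to the other,
both being integrable. -/
theorem _root_.SchwartzMap.integral_mul_conj_fourierInv (s : 𝓢(ℝ, ℂ)) {γ H : ℝ → ℂ}
    (hH : Integrable H)
    (hγ : ∀ t : ℝ, ∫ ξ : ℝ, H ξ * Complex.exp (2 * Real.pi * Complex.I * t * ξ) = γ t) :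
    ∫ t, s t * conj (γ t) = ∫ ξ, 𝓕 s ξ * conj (H ξ) := by
  have hHc : Integrable (fun ξ => conj (H ξ)) :=
    Complex.conjLIE.integrable_comp_iff.2 hH
  have h := VectorFourier.integral_fourierIntegral_smul_eq_flip (μ := volume) (ν := volume)
    (L := innerₗ ℝ) (f := (s : ℝ → ℂ)) (g := fun ξ => conj (H ξ)) Real.continuous_fourierChar
    continuous_inner s.integrable hHc
  rw [SchwartzMap.fourier_coe]
  refine Eq.trans ?_ h.symm
  refine integral_congr_ae (Filter.Eventually.of_forall fun t => ?_)
  simp only [VectorFourier.fourierIntegral, smul_eq_mul]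
  rw [← hγ t, ← integral_conj]
  congr 1
  refine integral_congr_ae (Filter.Eventually.of_forall fun ξ => ?_)
  simp only [Circle.smul_def, Real.fourierChar_apply, smul_eq_mul, map_mul, ← Complex.exp_conj,
    LinearMap.flip_apply, innerₗ_apply_apply, RCLike.inner_apply, Complex.conj_ofReal,
    Complex.conj_I, conj_trivial]
  rw [mul_comm]
  congr 2
  have : (starRingEnd ℂ) 2 = 2 := Complex.conj_ofReal 2
  rw [this]
  push_cast
  ring

/-- Both pairings are continuous in the L² class of f, so the Schwartz case extends by density. The
L² transform of γ never has to be identified with H. -/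
theorem integral_mul_conj_eq_of_fourier {f φ γ H : ℝ → ℂ} (hf : MemLp f 2 volume)
    (hφ : MemLp φ 2 volume) (hγ2 : MemLp γ 2 volume) (hH : Integrable H)
    (hH2 : MemLp H 2 volume)
    (hγ : ∀ t : ℝ, ∫ ξ : ℝ, H ξ * Complex.exp (2 * Real.pi * Complex.I * t * ξ) = γ t)
    (hfφ : 𝓕 (hf.toLp f) = hφ.toLp φ) :
    ∫ t, f t * conj (γ t) = ∫ ξ, φ ξ * conj (H ξ) := by
  have key : ∀ F : Lp ℂ 2 (volume : Measure ℝ),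
      inner ℂ (hγ2.toLp γ) F = inner ℂ (hH2.toLp H) (𝓕 F) := by
    intro F
    refine DenseRange.induction_on
      (p := fun F : Lp ℂ 2 (volume : Measure ℝ) =>
        inner ℂ (hγ2.toLp γ) F = inner ℂ (hH2.toLp H) (𝓕 F))
      (SchwartzMap.denseRange_toLpCLM (p := 2) ENNReal.ofNat_ne_top) F ?_ fun s => ?_
    · exact isClosed_eq (by fun_prop)
        (continuous_const.inner (Lp.fourierTransformₗᵢ ℝ ℂ).continuous)
    · rw [SchwartzMap.toLpCLM_apply, SchwartzMap.toLp_fourier_eq, L2.inner_def, L2.inner_def]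
      have h := s.integral_mul_conj_fourierInv hH hγ
      refine (integral_congr_ae ?_).trans (h.trans (integral_congr_ae ?_))
      · filter_upwards [hγ2.coeFn_toLp, s.coeFn_toLp 2] with x h1 h2
        simp [h1, h2]
      · filter_upwards [hH2.coeFn_toLp, (𝓕 s).coeFn_toLp 2] with x h1 h2
        simp [h1, h2]
  have h := key (hf.toLp f)
  rw [hfφ, L2.inner_def, L2.inner_def] at h
  refine (integral_congr_ae ?_).trans (h.trans (integral_congr_ae ?_))
  · filter_upwards [hγ2.coeFn_toLp, hf.coeFn_toLp] with x h1 h2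
    simp [h1, h2]
  · filter_upwards [hH2.coeFn_toLp, hφ.coeFn_toLp] with x h1 h2
    simp [h1, h2]

end Plancherel

/-! ### Cauchy kernels and their Fourier transforms -/

section CauchyAtom

/-- The modulated and translated Cauchy kernel `t ↦ e^{2πiωt} / (t - x - iw)`. -/
def cauchyAtom (w x ω t : ℝ) : ℂ :=
  Complex.exp (2 * Real.pi * Complex.I * ω * t) / (t - x - Complex.I * w)

/-- The Fourier transform of the Cauchy atom. -/
def cauchyAtomHat (w x ω : ℝ) : ℝ → ℂ := (Ioi ω).indicator fun ξ =>
  -2 * Real.pi * Complex.I *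
    Complex.exp ((2 * Real.pi * w - 2 * Real.pi * Complex.I * x) * (ξ - ω))

theorem cauchy_denom_ne_zero {w : ℝ} (hw : w < 0) (x t : ℝ) :
    (t - x - Complex.I * w : ℂ) ≠ 0 := by
  intro h
  have := congrArg Complex.im h
  simp at this
  exact hw.ne this

theorem continuous_cauchyAtom {w : ℝ} (hw : w < 0) (x ω : ℝ) : Continuous (cauchyAtom w x ω) := by
  unfold cauchyAtom
  exact Continuous.div (by fun_prop) (by fun_prop) fun t => cauchy_denom_ne_zero hw x t

theorem norm_exp_two_pi_I (ω t : ℝ) :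
    ‖Complex.exp (2 * Real.pi * Complex.I * ω * t)‖ = 1 := by
  rw [Complex.norm_exp]
  simp

theorem norm_cauchyAtom_sq {w : ℝ} (x ω t : ℝ) :
    ‖cauchyAtom w x ω t‖ ^ 2 = ((t - x) ^ 2 + w ^ 2)⁻¹ := by
  have : ‖(t - x - Complex.I * w : ℂ)‖ ^ 2 = (t - x) ^ 2 + w ^ 2 := by
    rw [← Complex.normSq_eq_norm_sq, Complex.normSq_apply]
    simp
    ring
  rw [cauchyAtom, norm_div, norm_exp_two_pi_I, div_pow, this, one_pow, one_div]

theorem memLp_cauchyAtom {w : ℝ} (hw : w < 0) (x ω : ℝ) : MemLp (cauchyAtom w x ω) 2 volume := by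
  rw [memLp_two_iff_integrable_sq_norm (continuous_cauchyAtom hw x ω).aestronglyMeasurable]
  simp_rw [norm_cauchyAtom_sq]
  -- The integrand is 1/(1 + t²) rescaled by w, translated by x and divided by w².
  have h := ((integrable_inv_one_add_sq.comp_div hw.ne).comp_sub_right x).const_mul (w ^ 2)⁻¹
  refine h.congr (Filter.Eventually.of_forall fun t => ?_)
  have hw' : w ≠ 0 := hw.ne
  simp only
  rw [← mul_inv]
  congr 1
  field_simp
  ring

theorem cauchyAtomHat_eq (w x ω : ℝ) : cauchyAtomHat w x ω = (Ioi ω).indicator fun ξ : ℝ =>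
    (-2 * Real.pi * Complex.I *
      Complex.exp (-((2 * Real.pi * w - 2 * Real.pi * Complex.I * x) * ω))) *
      Complex.exp ((2 * Real.pi * w - 2 * Real.pi * Complex.I * x) * ξ) := by
  unfold cauchyAtomHat
  congr 1
  ext ξ
  rw [mul_assoc _ (Complex.exp _) (Complex.exp _), ← Complex.exp_add]
  ring_nf

theorem exponent_re_neg {w : ℝ} (hw : w < 0) (x : ℝ) :
    (2 * Real.pi * w - 2 * Real.pi * Complex.I * x : ℂ).re < 0 := by
  simp
  exact mul_neg_of_pos_of_neg Real.two_pi_pos hw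

theorem integrable_cauchyAtomHat {w : ℝ} (hw : w < 0) (x ω : ℝ) :
    Integrable (cauchyAtomHat w x ω) := by
  rw [cauchyAtomHat_eq, integrable_indicator_iff measurableSet_Ioi]
  exact (integrableOn_exp_mul_complex_Ioi (exponent_re_neg hw x) ω).const_mul _

theorem memLp_cauchyAtomHat {w : ℝ} (hw : w < 0) (x ω : ℝ) :
    MemLp (cauchyAtomHat w x ω) 2 volume := by
  have h := integrable_cauchyAtomHat hw x ω
  -- A bounded integrable function is square integrable; the exponential has modulus at most 1 on ξ
  -- > ω because w < 0.
  have hb : ∀ ξ, ‖cauchyAtomHat w x ω ξ‖ ≤ 2 * Real.pi := by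
    intro ξ
    rw [cauchyAtomHat]
    by_cases hξ : ξ ∈ Ioi ω
    · rw [indicator_of_mem hξ, norm_mul, Complex.norm_exp]
      have h1 : ‖(-2 * Real.pi * Complex.I : ℂ)‖ = 2 * Real.pi := by
        simp [abs_of_pos Real.pi_pos]
      rw [h1]
      refine mul_le_of_le_one_right Real.two_pi_pos.le (Real.exp_le_one_iff.2 ?_)
      have e : ((2 * Real.pi * w - 2 * Real.pi * Complex.I * x) * (ξ - ω) : ℂ).re =
          2 * Real.pi * w * (ξ - ω) := by simp
      rw [e]
      exact mul_nonpos_of_nonpos_of_nonneg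
        (mul_nonpos_of_nonneg_of_nonpos Real.two_pi_pos.le hw.le) (sub_nonneg.2 (le_of_lt hξ))
    · rw [indicator_of_notMem hξ, norm_zero]
      exact Real.two_pi_pos.le
  rw [memLp_two_iff_integrable_sq_norm h.1]
  refine (h.norm.const_mul (2 * Real.pi)).mono' (h.1.norm.pow 2)
    (Filter.Eventually.of_forall fun ξ => ?_)
  rw [Real.norm_of_nonneg (by positivity), sq]
  exact mul_le_mul_of_nonneg_right (hb ξ) (norm_nonneg _)

theorem integral_cauchyAtomHat_mul_exp {w : ℝ} (hw : w < 0) (x ω t : ℝ) :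
    ∫ ξ : ℝ, cauchyAtomHat w x ω ξ * Complex.exp (2 * Real.pi * Complex.I * t * ξ) =
      cauchyAtom w x ω t := by
  have e : (fun ξ : ℝ => cauchyAtomHat w x ω ξ *
      Complex.exp (2 * Real.pi * Complex.I * t * ξ)) = (Ioi ω).indicator fun ξ : ℝ =>
      (-2 * Real.pi * Complex.I *
      Complex.exp (-((2 * Real.pi * w - 2 * Real.pi * Complex.I * x) * ω))) *
      Complex.exp ((2 * Real.pi * w - 2 * Real.pi * Complex.I * (x - t : ℝ)) * ξ) := by
    rw [cauchyAtomHat_eq]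
    ext ξ
    by_cases hξ : ξ ∈ Ioi ω
    · rw [indicator_of_mem hξ, indicator_of_mem hξ, mul_assoc _ (Complex.exp _) (Complex.exp _),
        ← Complex.exp_add]
      push_cast
      ring_nf
    · rw [indicator_of_notMem hξ, indicator_of_notMem hξ, zero_mul]
  rw [e, integral_indicator measurableSet_Ioi, integral_const_mul,
    integral_exp_mul_complex_Ioi (exponent_re_neg hw _), cauchyAtom]
  -- The exponent of the integrated exponential is 2πi times the Cauchy denominator, which is what
  -- cancels the prefactor -2πi up to the sign of the boundary term.
  have hd : (2 * Real.pi * w - 2 * Real.pi * Complex.I * (x - t : ℝ) : ℂ) =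
      2 * Real.pi * Complex.I * (t - x - Complex.I * w) := by
    push_cast
    linear_combination (2 * Real.pi * w : ℂ) * Complex.I_sq
  have hne := cauchy_denom_ne_zero hw x t
  have hπ : (Real.pi : ℂ) ≠ 0 := by exact_mod_cast Real.pi_ne_zero
  have hexp : Complex.exp (2 * Real.pi * Complex.I * ω * t) =
      Complex.exp (-((2 * Real.pi * w - 2 * Real.pi * Complex.I * x) * ω)) *
      Complex.exp ((2 * Real.pi * w - 2 * Real.pi * Complex.I * (x - t : ℝ)) * ω) := by
    rw [← Complex.exp_add]
    push_cast
    ring_nf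
  rw [hexp]
  generalize Complex.exp (_ * (ω : ℂ)) = E₁
  generalize Complex.exp (-_) = E₂
  rw [hd]
  have hI := Complex.I_ne_zero
  field_simp

end CauchyAtom

/-! ### Translations in L² -/

section Translation

theorem memLp_comp_add_right {G : ℝ → ℂ} (hG : MemLp G 2 volume) (c : ℝ) :
    MemLp (fun x => G (x + c)) 2 volume :=
  hG.comp_measurePreserving (measurePreserving_add_right volume c)

theorem eLpNorm_comp_add_right {G : ℝ → ℂ} (hG : MemLp G 2 volume) (c : ℝ) :
    eLpNorm (fun x => G (x + c)) 2 volume = eLpNorm G 2 volume :=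
  eLpNorm_comp_measurePreserving hG.1 (measurePreserving_add_right volume c)

end Translation

/-! ### Pairings with Cauchy kernels as Fourier coefficients on (0, p] -/

section Coefficients

/-- Shifting the exponential by p and multiplying by e^{2πwp} reproduces it exactly when e^{2πixp} =
1, so the two half-line tails cancel beyond ω + p. -/
theorem cauchyAtomHat_sub_shift {w x p : ℝ} (hp : 0 < p)
    (hx : Complex.exp (2 * Real.pi * Complex.I * x * p) = 1) (ω ξ : ℝ) :
    cauchyAtomHat w x ω ξ - Real.exp (2 * Real.pi * w * p) * cauchyAtomHat w x ω (ξ - p) =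
      (Ioc ω (ω + p)).indicator (fun ξ : ℝ => -2 * Real.pi * Complex.I *
        Complex.exp ((2 * Real.pi * w - 2 * Real.pi * Complex.I * x) * (ξ - ω))) ξ := by
  have hexp : (Real.exp (2 * Real.pi * w * p) : ℂ) *
      Complex.exp ((2 * Real.pi * w - 2 * Real.pi * Complex.I * x) * ((ξ - p : ℝ) - ω)) =
      Complex.exp ((2 * Real.pi * w - 2 * Real.pi * Complex.I * x) * (ξ - ω)) := by
    rw [← mul_one (Complex.exp (_ * ((ξ : ℂ) - ω))), ← hx, Complex.ofReal_exp, ← Complex.exp_add,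
      ← Complex.exp_add]
    push_cast
    ring_nf
  simp only [cauchyAtomHat, indicator, mem_Ioi, mem_Ioc]
  by_cases h1 : ω < ξ
  · by_cases h2 : ω < ξ - p
    · rw [if_pos h1, if_pos h2, if_neg (by rintro ⟨_, _⟩; linarith), ← hexp]
      ring
    · rw [if_pos h1, if_neg h2, if_pos ⟨h1, by linarith⟩]
      ring
  · rw [if_neg h1, if_neg (by linarith), if_neg (fun h => h1 h.1)]
    ring

/-- Translation invariance moves the shift by p from G to the transformed kernel, where the tails
cancel; the substitution ξ = s + ω then leaves an integral over (0, p]. -/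
theorem integral_mul_conj_cauchyAtomHat {w x p : ℝ} (hw : w < 0) (hp : 0 < p)
    (hx : Complex.exp (2 * Real.pi * Complex.I * x * p) = 1) {φ G : ℝ → ℂ}
    (hG : MemLp G 2 volume)
    (hφ : φ =ᵐ[volume] fun ξ => conj (G ξ - Real.exp (2 * Real.pi * w * p) * G (ξ + p)))
    (ω : ℝ) :
    ∫ ξ, φ ξ * conj (cauchyAtomHat w x ω ξ) = 2 * Real.pi * Complex.I *
      conj (∫ s in Ioc 0 p, Real.exp (2 * Real.pi * w * s) * G (s + ω) *
        Complex.exp (-(2 * Real.pi * Complex.I * x * s))) := by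
  set q : ℂ := ((Real.exp (2 * Real.pi * w * p) : ℝ) : ℂ) with hq
  have hH := memLp_cauchyAtomHat hw x ω
  have i1 : Integrable fun ξ => G ξ * cauchyAtomHat w x ω ξ := hG.integrable_mul hH
  have i2 : Integrable fun ξ => G (ξ + p) * cauchyAtomHat w x ω ξ :=
    (memLp_comp_add_right hG p).integrable_mul hH
  have i3 : Integrable fun ξ => G ξ * cauchyAtomHat w x ω (ξ - p) := by
    simpa using i2.comp_sub_right p
  have e2 : ∫ ξ, G (ξ + p) * cauchyAtomHat w x ω ξ = ∫ ξ, G ξ * cauchyAtomHat w x ω (ξ - p) := by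
    rw [← integral_sub_right_eq_self _ p]
    simp
  have e3 : ∫ ξ, (G ξ - q * G (ξ + p)) * cauchyAtomHat w x ω ξ =
      -(2 * Real.pi * Complex.I) * ∫ s in Ioc 0 p, Real.exp (2 * Real.pi * w * s) * G (s + ω) *
        Complex.exp (-(2 * Real.pi * Complex.I * x * s)) := by
    calc ∫ ξ, (G ξ - q * G (ξ + p)) * cauchyAtomHat w x ω ξ
        = ∫ ξ, (G ξ * cauchyAtomHat w x ω ξ - q * (G (ξ + p) * cauchyAtomHat w x ω ξ)) := by
          congr 1; ext ξ; ring
      _ = (∫ ξ, G ξ * cauchyAtomHat w x ω ξ) - q * ∫ ξ, G ξ * cauchyAtomHat w x ω (ξ - p) := by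
          rw [integral_sub i1 (i2.const_mul q), integral_const_mul, e2]
      _ = ∫ ξ, (G ξ * cauchyAtomHat w x ω ξ - q * (G ξ * cauchyAtomHat w x ω (ξ - p))) := by
          rw [integral_sub i1 (i3.const_mul q), integral_const_mul]
      _ = ∫ ξ, (Ioc ω (ω + p)).indicator (fun ξ : ℝ => G ξ * (-2 * Real.pi * Complex.I *
        Complex.exp ((2 * Real.pi * w - 2 * Real.pi * Complex.I * x) * (ξ - ω)))) ξ := by
          congr 1; ext ξ
          rw [indicator_mul_right, ← cauchyAtomHat_sub_shift hp hx]
          ring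
      _ = ∫ ξ in (0 + ω)..(p + ω), G ξ * (-2 * Real.pi * Complex.I *
        Complex.exp ((2 * Real.pi * w - 2 * Real.pi * Complex.I * x) * (ξ - ω))) := by
          rw [integral_indicator measurableSet_Ioc, intervalIntegral.integral_of_le (by linarith),
            zero_add, add_comm p]
      _ = _ := by
          rw [← intervalIntegral.integral_comp_add_right, intervalIntegral.integral_of_le hp.le,
            ← integral_const_mul]
          refine integral_congr_ae (Filter.Eventually.of_forall fun s => ?_)
          have : Complex.exp ((2 * Real.pi * w - 2 * Real.pi * Complex.I * x) *
              ((s + ω : ℝ) - ω)) = Real.exp (2 * Real.pi * w * s) *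
              Complex.exp (-(2 * Real.pi * Complex.I * x * s)) := by
            rw [Complex.ofReal_exp, ← Complex.exp_add]
            push_cast
            ring_nf
          simp only [this]
          ring
  have e4 : ∫ ξ, φ ξ * conj (cauchyAtomHat w x ω ξ) =
      ∫ ξ, conj ((G ξ - q * G (ξ + p)) * cauchyAtomHat w x ω ξ) := by
    refine integral_congr_ae ?_
    filter_upwards [hφ] with ξ hξ
    rw [hξ, map_mul]
  have h2 : (starRingEnd ℂ) 2 = 2 := Complex.conj_ofReal 2
  rw [e4, integral_conj, e3, map_mul]
  congr 1
  simp [h2]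

/-- The function `s ↦ e^{2πws} G(s + m + b)`. -/
def weightedTranslate (w : ℝ) (m : ℤ) (b : ℝ) (G : ℝ → ℂ) (s : ℝ) : ℂ :=
  Real.exp (2 * Real.pi * w * s) * G (s + m + b)

/-- The function `a_k e^{2πwt} A_k G(t + m + b_k)`. -/
def unweightedTerm (a : ℕ → ℂ) (b : ℕ → ℝ) (w p : ℝ) (G : ℝ → ℂ) (m : ℤ) (k : ℕ) (t : ℝ) : ℂ :=
  a k * weightedTranslate w m (b k) G (circularMap p (modPeriod p (b k)) t)

variable (a : ℕ → ℂ) (b : ℕ → ℝ)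

theorem shiftTerm_eq (w α : ℝ) (G : ℝ → ℂ) (m : ℤ) (k : ℕ) (t : ℝ) :
    shiftTerm a b w α G m k t =
      Real.exp (-2 * Real.pi * w * t) * unweightedTerm a b w (1 / α) G m k t := by
  simp only [shiftTerm, weightedShift, circularShift_eq_comp, mulOp, Function.comp,
    unweightedTerm, weightedTranslate]
  ring

theorem unweightedTerm_eq (w α : ℝ) (G : ℝ → ℂ) (m : ℤ) (k : ℕ) (t : ℝ) :
    unweightedTerm a b w (1 / α) G m k t =
      Real.exp (2 * Real.pi * w * t) * shiftTerm a b w α G m k t := by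
  rw [shiftTerm_eq, ← mul_assoc, ← Complex.ofReal_mul, ← Real.exp_add]
  ring_nf
  simp

theorem aestronglyMeasurable_weightedTranslate (w : ℝ) (m : ℤ) (c : ℝ) {G : ℝ → ℂ}
    (hG : MemLp G 2 volume) : AEStronglyMeasurable (weightedTranslate w m c G) volume := by
  have h := (memLp_comp_add_right hG (m + c)).1
  simp_rw [← add_assoc] at h
  exact (Continuous.aestronglyMeasurable (by fun_prop)).mul h

/-- For w < 0 the weight e^{2πws} is at most 1 on s > 0. The bound does not depend on m or c, so the
series is controlled by the sum of |a_k|. -/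
theorem eLpNorm_weightedTranslate_le {w : ℝ} (hw : w < 0) (p : ℝ) (m : ℤ) (c : ℝ) {G : ℝ → ℂ}
    (hG : MemLp G 2 volume) :
    eLpNorm (weightedTranslate w m c G) 2 (volume.restrict (Ioc 0 p)) ≤ eLpNorm G 2 volume := by
  rw [← eLpNorm_comp_add_right hG (m + c)]
  refine (eLpNorm_mono_ae (g := fun x => G (x + (m + c))) ?_).trans
    (eLpNorm_mono_measure _ Measure.restrict_le_self)
  filter_upwards [ae_restrict_mem measurableSet_Ioc] with s hs
  rw [weightedTranslate, norm_mul, Complex.norm_real, add_assoc,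
    Real.norm_of_nonneg (Real.exp_pos _).le]
  refine mul_le_of_le_one_left (norm_nonneg _) (Real.exp_le_one_iff.2 ?_)
  exact mul_nonpos_of_nonpos_of_nonneg
    (mul_nonpos_of_nonneg_of_nonpos Real.two_pi_pos.le hw.le) hs.1.le

theorem aestronglyMeasurable_unweightedTerm {w p : ℝ} (hp : 0 < p) {G : ℝ → ℂ}
    (hG : MemLp G 2 volume) (m : ℤ) (k : ℕ) :
    AEStronglyMeasurable (unweightedTerm a b w p G m k) (volume.restrict (Ioc 0 p)) :=
  ((aestronglyMeasurable_weightedTranslate w m (b k) hG).restrict.comp_measurePreserving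
    (measurePreserving_circularMap (modPeriod_nonneg hp (b k)) (modPeriod_lt hp (b k)))).const_mul
    (a k)

theorem eLpNorm_unweightedTerm_le {w p : ℝ} (hw : w < 0) (hp : 0 < p) {G : ℝ → ℂ}
    (hG : MemLp G 2 volume) (m : ℤ) (k : ℕ) :
    eLpNorm (unweightedTerm a b w p G m k) 2 (volume.restrict (Ioc 0 p)) ≤
      (‖a k‖₊ * (eLpNorm G 2 volume).toNNReal : ℝ≥0) := by
  have h := eLpNorm_comp_measurePreserving (p := 2)
    (aestronglyMeasurable_weightedTranslate w m (b k) hG).restrict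
    (measurePreserving_circularMap (modPeriod_nonneg hp (b k)) (modPeriod_lt hp (b k)))
  have e : unweightedTerm a b w p G m k =
      a k • (weightedTranslate w m (b k) G ∘ circularMap p (modPeriod p (b k))) := by
    ext t; simp [unweightedTerm]
  rw [e, eLpNorm_const_smul, h, ENNReal.coe_mul, ENNReal.coe_toNNReal hG.2.ne]
  exact mul_le_mul_right (eLpNorm_weightedTranslate_le hw p m (b k) hG) _

variable {a b}

theorem summable_nnnorm_mul (ha : Summable fun k => ‖a k‖) (c : ℝ≥0) :
    Summable fun k => ‖a k‖₊ * c :=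
  (NNReal.summable_coe.1 (by simpa using ha) : Summable fun k => ‖a k‖₊).mul_right c

theorem ae_summable_shiftTerm {w α : ℝ} (ha : Summable fun k => ‖a k‖) (hw : w < 0) (hα : 0 < α)
    {G : ℝ → ℂ} (hG : MemLp G 2 volume) (m : ℤ) :
    ∀ᵐ t ∂(volume.restrict (Ioc 0 (1 / α))), Summable fun k => shiftTerm a b w α G m k t := by
  have hp : 0 < 1 / α := by positivity
  filter_upwards [ae_summable_norm_of_eLpNorm_le (summable_nnnorm_mul ha _)
    (fun k => aestronglyMeasurable_unweightedTerm a b hp hG m k)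
    (fun k => eLpNorm_unweightedTerm_le a b hw hp hG m k)] with t ht
  simp_rw [shiftTerm_eq]
  exact ht.of_norm.mul_left _

/-- Substitute the circular map in the integral: it preserves measure, and changes the exponential
by exactly the phase e^{2πixc}, as multiples of p are invisible to it. -/
theorem exp_mul_integral_weightedTranslate {p x : ℝ} (hp : 0 < p)
    (hx : Complex.exp (2 * Real.pi * Complex.I * x * p) = 1) {G : ℝ → ℂ} (w : ℝ)
    (hG : MemLp G 2 volume) (m : ℤ) (c : ℝ) :
    Complex.exp (-(2 * Real.pi * Complex.I * x * c)) *
      ∫ s in Ioc 0 p, weightedTranslate w m c G s *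
        Complex.exp (-(2 * Real.pi * Complex.I * x * s)) =
    ∫ t in Ioc 0 p, weightedTranslate w m c G (circularMap p (modPeriod p c) t) *
        Complex.exp (-(2 * Real.pi * Complex.I * x * t)) := by
  have hmp := measurePreserving_circularMap (modPeriod_nonneg hp c) (modPeriod_lt hp c)
  have hmeas : AEStronglyMeasurable (fun s : ℝ => weightedTranslate w m c G s *
      Complex.exp (-(2 * Real.pi * Complex.I * x * s))) (volume.restrict (Ioc 0 p)) :=
    (aestronglyMeasurable_weightedTranslate w m c hG).restrict.mul
      (Continuous.aestronglyMeasurable (by fun_prop))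
  rw [← hmp.map_eq, integral_map hmp.measurable.aemeasurable (hmp.map_eq.symm ▸ hmeas),
    hmp.map_eq, ← integral_const_mul]
  refine integral_congr_ae (Filter.Eventually.of_forall fun t => ?_)
  obtain ⟨j, hj⟩ := exists_int_circularMap_modPeriod hp c t
  have hper : Complex.exp (-(2 * Real.pi * Complex.I * x * c)) *
      Complex.exp (-(2 * Real.pi * Complex.I * x * (circularMap p (modPeriod p c) t))) =
      Complex.exp (-(2 * Real.pi * Complex.I * x * t)) := by
    have h1 : Complex.exp ((-j : ℤ) * (2 * Real.pi * Complex.I * x * p)) = 1 := by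
      rw [Complex.exp_int_mul, hx, one_zpow]
    rw [hj, ← mul_one (Complex.exp (-(2 * Real.pi * Complex.I * x * t))), ← h1,
      ← Complex.exp_add, ← Complex.exp_add]
    push_cast
    ring_nf
  simp only [← hper]
  ring

end Coefficients

/-! ### The frame sum as an unweighted shift energy -/

section FrameSum

open scoped FourierTransform

variable {a : ℕ → ℂ} {b : ℕ → ℝ}

/-- Translating the window by αn turns the frequency b_k into a constant phase, while the modulation
raises it to m + b_k. -/
theorem gaborSystem_window_eq (w α : ℝ) (m n : ℤ) (t : ℝ) :
    gaborSystem (window a b w) α 1 (m, n) t =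
      ∑' k, a k * Complex.exp (-(2 * Real.pi * Complex.I * (α * n : ℝ) * b k)) *
        cauchyAtom w (α * n) (m + b k) t := by
  simp only [gaborSystem, timeFreqShift, window, trigSeries]
  rw [← tsum_div_const, ← tsum_mul_left]
  refine tsum_congr fun k => ?_
  have h : Complex.exp (2 * Real.pi * Complex.I * (1 * m : ℝ) * t) *
      Complex.exp (2 * Real.pi * Complex.I * b k * (t - α * n : ℝ)) =
      Complex.exp (-(2 * Real.pi * Complex.I * (α * n : ℝ) * b k)) *
      Complex.exp (2 * Real.pi * Complex.I * (m + b k : ℝ) * t) := by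
    rw [← Complex.exp_add, ← Complex.exp_add]
    push_cast
    ring_nf
  rw [cauchyAtom, mul_div_assoc', mul_div_assoc', mul_left_comm, mul_assoc (a k), h]
  push_cast
  rfl

theorem norm_cauchyAtom_eq (w x ω t : ℝ) : ‖cauchyAtom w x ω t‖ = ‖cauchyAtom w x 0 t‖ := by
  rw [← sq_eq_sq₀ (norm_nonneg _) (norm_nonneg _), norm_cauchyAtom_sq, norm_cauchyAtom_sq]

theorem memLp_window {w : ℝ} (ha : Summable fun k => ‖a k‖) (hw : w < 0) :
    MemLp (window a b w) 2 volume := by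
  have hcont : Continuous (trigSeries a b) := by
    refine continuous_tsum (fun k => by fun_prop) ha fun k t => ?_
    rw [norm_mul, norm_exp_two_pi_I, mul_one]
  have hwin : Continuous (window a b w) :=
    hcont.div (by fun_prop) fun t => by simpa using cauchy_denom_ne_zero hw 0 t
  refine (memLp_cauchyAtom hw 0 0).of_le_mul (c := ∑' k, ‖a k‖) hwin.aestronglyMeasurable
    (Filter.Eventually.of_forall fun t => ?_)
  have hP : ‖trigSeries a b t‖ ≤ ∑' k, ‖a k‖ :=
    tsum_of_norm_bounded ha.hasSum fun k => by rw [norm_mul, norm_exp_two_pi_I, mul_one]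
  rw [window, cauchyAtom, norm_div, norm_div, norm_exp_two_pi_I, Complex.ofReal_zero, sub_zero,
    mul_one_div]
  gcongr

/-- Both sides are expanded in k, with sum and integral interchanged by absolute convergence; the
k-th terms then agree by the Plancherel pairing and the phase-to-shift identity. -/
theorem innerL2_gaborSystem_window {w α : ℝ} (ha : Summable fun k => ‖a k‖) (hw : w < 0)
    (hα : 0 < α) {f φ G : ℝ → ℂ} (hf : MemLp f 2 volume) (hφ2 : MemLp φ 2 volume)
    (hG : MemLp G 2 volume) (hfφ : 𝓕 (hf.toLp f) = hφ2.toLp φ)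
    (hφ : φ =ᵐ[volume] fun ξ => conj (G ξ - Real.exp (2 * Real.pi * w * (1 / α)) *
      G (ξ + 1 / α))) (m n : ℤ) :
    innerL2 f (gaborSystem (window a b w) α 1 (m, n)) = 2 * Real.pi * Complex.I *
      conj (∫ t in Ioc 0 (1 / α), (∑' k, unweightedTerm a b w (1 / α) G m k t) *
        Complex.exp (-(2 * Real.pi * Complex.I * n * t / (1 / α : ℝ)))) := by
  have hp : 0 < 1 / α := by positivity
  have hα' : (α : ℂ) ≠ 0 := by exact_mod_cast hα.ne'
  set x : ℝ := α * n with hxdef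
  have hx : Complex.exp (2 * Real.pi * Complex.I * x * (1 / α : ℝ)) = 1 := by
    rw [← Complex.exp_int_mul_two_pi_mul_I n]
    congr 1
    rw [hxdef]
    push_cast
    field_simp
  have hE : ∀ t : ℝ, Complex.exp (-(2 * Real.pi * Complex.I * n * t / (1 / α : ℝ))) =
      Complex.exp (-(2 * Real.pi * Complex.I * x * t)) := by
    intro t
    rw [hxdef]
    push_cast
    congr 1
    field_simp
  have hEn : ∀ s t : ℝ, ‖Complex.exp (-(2 * Real.pi * Complex.I * s * t))‖ = 1 := by
    intro s t
    rw [← norm_exp_two_pi_I (-s) t]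
    push_cast
    ring_nf
  simp_rw [hE]
  -- the left side as a series
  have hL : innerL2 f (gaborSystem (window a b w) α 1 (m, n)) =
      ∑' k, ∫ t, f t * conj (a k * Complex.exp (-(2 * Real.pi * Complex.I * x * b k)) *
        cauchyAtom w x (m + b k) t) := by
    have hint : ∀ k, Integrable fun t => f t *
        conj (a k * Complex.exp (-(2 * Real.pi * Complex.I * x * b k)) *
        cauchyAtom w x (m + b k) t) := fun k =>
      hf.integrable_mul (((memLp_cauchyAtom hw x (m + b k)).const_mul _).star)
    -- The modulus of the kernel does not depend on its frequency, so k enters only through |a_k|.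
    have hnorm : ∀ k t, ‖f t * conj (a k * Complex.exp (-(2 * Real.pi * Complex.I * x * b k)) *
        cauchyAtom w x (m + b k) t)‖ = ‖a k‖ * (‖f t‖ * ‖cauchyAtom w x 0 t‖) := by
      intro k t
      rw [norm_mul, RCLike.norm_conj, norm_mul, norm_mul, hEn, norm_cauchyAtom_eq]
      ring
    rw [integral_tsum_of_summable_integral_norm hint]
    · rw [innerL2]
      congr 1
      ext t
      rw [gaborSystem_window_eq, Complex.conj_tsum, tsum_mul_left]
    · simp_rw [hnorm, integral_const_mul]
      exact ha.mul_right _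
  -- the right side as a series
  have hR : ∫ t in Ioc 0 (1 / α), (∑' k, unweightedTerm a b w (1 / α) G m k t) *
        Complex.exp (-(2 * Real.pi * Complex.I * x * t)) =
      ∑' k, ∫ t in Ioc 0 (1 / α), unweightedTerm a b w (1 / α) G m k t *
        Complex.exp (-(2 * Real.pi * Complex.I * x * t)) := by
    have hm := fun k => aestronglyMeasurable_unweightedTerm a b (w := w) hp hG m k
    have hle := fun k => eLpNorm_unweightedTerm_le a b hw hp hG m k
    rw [integral_tsum_of_summable_integral_norm]
    · congr 1
      ext t
      rw [tsum_mul_right]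
    · intro k
      have h1 : MemLp (unweightedTerm a b w (1 / α) G m k) 1 (volume.restrict (Ioc 0 (1 / α))) :=
        MemLp.mono_exponent (q := 2) ⟨hm k, (hle k).trans_lt ENNReal.coe_lt_top⟩ (by norm_num)
      refine (memLp_one_iff_integrable.1 h1).mul_bdd (c := 1)
        (Continuous.aestronglyMeasurable (by fun_prop))
        (Filter.Eventually.of_forall fun t => (hEn x t).le)
    · simp_rw [norm_mul, hEn, mul_one]
      exact summable_integral_norm_of_eLpNorm_le (summable_nnnorm_mul ha _) hm hle
  rw [hL, hR, Complex.conj_tsum, ← tsum_mul_left]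
  refine tsum_congr fun k => ?_
  have h1 := integral_mul_conj_eq_of_fourier hf hφ2 (memLp_cauchyAtom hw x (m + b k))
    (integrable_cauchyAtomHat hw x (m + b k)) (memLp_cauchyAtomHat hw x (m + b k))
    (integral_cauchyAtomHat_mul_exp hw x (m + b k)) hfφ
  rw [integral_mul_conj_cauchyAtomHat hw hp hx hG hφ] at h1
  have h2 := exp_mul_integral_weightedTranslate hp hx w hG m (b k)
  have e1 : ∫ t, f t * conj (a k * Complex.exp (-(2 * Real.pi * Complex.I * x * b k)) *
        cauchyAtom w x (m + b k) t) =
      conj (a k * Complex.exp (-(2 * Real.pi * Complex.I * x * b k))) *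
        ∫ t, f t * conj (cauchyAtom w x (m + b k) t) := by
    rw [← integral_const_mul]
    congr 1; ext t
    rw [map_mul (starRingEnd ℂ) (_ * _)]
    ring
  have e2 : ∫ t in Ioc 0 (1 / α), unweightedTerm a b w (1 / α) G m k t *
        Complex.exp (-(2 * Real.pi * Complex.I * x * t)) =
      a k * ∫ t in Ioc 0 (1 / α), weightedTranslate w m (b k) G
        (circularMap (1 / α) (modPeriod (1 / α) (b k)) t) *
        Complex.exp (-(2 * Real.pi * Complex.I * x * t)) := by
    rw [← integral_const_mul]
    congr 1; ext t
    rw [unweightedTerm]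
    ring
  rw [e1, e2, h1, ← h2]
  simp only [weightedTranslate, map_mul, add_assoc]
  ring

theorem tsum_enorm_innerL2_gaborSystem_sq {w α : ℝ} (ha : Summable fun k => ‖a k‖) (hw : w < 0)
    (hα : 0 < α) {f φ G : ℝ → ℂ} (hf : MemLp f 2 volume) (hφ2 : MemLp φ 2 volume)
    (hG : MemLp G 2 volume) (hfφ : 𝓕 (hf.toLp f) = hφ2.toLp φ)
    (hφ : φ =ᵐ[volume] fun ξ => conj (G ξ - Real.exp (2 * Real.pi * w * (1 / α)) *
      G (ξ + 1 / α))) :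
    ∑' mn : ℤ × ℤ, ‖innerL2 f (gaborSystem (window a b w) α 1 mn)‖ₑ ^ 2 =
      ENNReal.ofReal ((2 * Real.pi) ^ 2 * (1 / α)) * ∑' m : ℤ, ∫⁻ t in Ioc 0 (1 / α),
        ‖∑' k, unweightedTerm a b w (1 / α) G m k t‖ₑ ^ 2 := by
  have hp : 0 < 1 / α := by positivity
  rw [ENNReal.tsum_prod', ← ENNReal.tsum_mul_left]
  refine tsum_congr fun m => ?_
  have hT := memLp_two_tsum (summable_nnnorm_mul ha _)
    (fun k => aestronglyMeasurable_unweightedTerm a b (w := w) hp hG m k)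
    (fun k => eLpNorm_unweightedTerm_le a b hw hp hG m k)
  have hc : ∀ z : ℂ, ‖2 * Real.pi * Complex.I * conj z‖ₑ ^ 2 =
      ENNReal.ofReal ((2 * Real.pi) ^ 2) * ‖z‖ₑ ^ 2 := fun z => by
    rw [← ofReal_norm, ← ofReal_norm, ← ENNReal.ofReal_pow (norm_nonneg _),
      ← ENNReal.ofReal_pow (norm_nonneg _), ← ENNReal.ofReal_mul (by positivity), ← mul_pow,
      norm_mul, RCLike.norm_conj]
    simp [abs_of_pos Real.pi_pos]
  simp_rw [innerL2_gaborSystem_window ha hw hα hf hφ2 hG hfφ hφ, hc]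
  rw [ENNReal.tsum_mul_left, tsum_enorm_integral_exp_sq hp hT, ENNReal.ofReal_mul (by positivity),
    mul_assoc]

end FrameSum

/-! ### The correspondence between f and G -/

section Correspondence

open scoped FourierTransform

variable {a : ℕ → ℂ} {b : ℕ → ℝ}

/-- The square integrable functions `f` and `G` correspond to each other if the Fourier transform
of `f` is the complex conjugate of `G - q G(· + p)`. -/
def FourierCorrespond (q p : ℝ) (f G : ℝ → ℂ) : Prop :=
  ∃ (φ : ℝ → ℂ) (hf : MemLp f 2 volume) (hφ : MemLp φ 2 volume), MemLp G 2 volume ∧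
    𝓕 (hf.toLp f) = hφ.toLp φ ∧ φ =ᵐ[volume] fun ξ => conj (G ξ - q * G (ξ + p))

theorem normSqL2_eq_enorm_toLp {f : ℝ → ℂ} (hf : MemLp f 2 volume) :
    normSqL2 f = ‖hf.toLp f‖ₑ ^ 2 := by
  rw [normSqL2, Lp.enorm_toLp]

theorem memLp_conj_sub_shift (q p : ℝ) {G : ℝ → ℂ} (hG : MemLp G 2 volume) :
    MemLp (fun ξ => conj (G ξ - q * G (ξ + p))) 2 volume :=
  (hG.sub ((memLp_comp_add_right hG p).const_mul q)).star

theorem FourierCorrespond.normSqL2_eq {q p : ℝ} {f G : ℝ → ℂ} (h : FourierCorrespond q p f G) :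
    normSqL2 f = normSqL2 (fun ξ => G ξ - q * G (ξ + p)) := by
  obtain ⟨φ, hf, hφ, hG, h1, h2⟩ := h
  have e : ‖hf.toLp f‖ₑ = ‖hφ.toLp φ‖ₑ := by
    rw [← h1, ← ofReal_norm, ← ofReal_norm, Lp.norm_fourier_eq]
  rw [normSqL2_eq_enorm_toLp hf, e, ← normSqL2_eq_enorm_toLp hφ, normSqL2, normSqL2]
  congr 1
  refine eLpNorm_congr_norm_ae ?_
  filter_upwards [h2] with ξ hξ
  rw [hξ, RCLike.norm_conj]

theorem eLpNorm_const_mul_shift {q : ℝ} (hq : 0 ≤ q) (p : ℝ) {G : ℝ → ℂ}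
    (hG : MemLp G 2 volume) :
    eLpNorm (fun ξ => (q : ℂ) * G (ξ + p)) 2 volume = ENNReal.ofReal q * eLpNorm G 2 volume := by
  have := eLpNorm_const_smul (q : ℂ) (fun ξ => G (ξ + p)) 2 volume
  rw [eLpNorm_comp_add_right hG, ← ofReal_norm, Complex.norm_real, Real.norm_of_nonneg hq] at this
  exact this

/-- Translation is an isometry, so the triangle inequality gives ‖f‖ ≤ (1 + q)‖G‖ and ‖G‖ ≤ ‖f‖ +
q‖G‖. -/
theorem FourierCorrespond.normSqL2_le {q p : ℝ} (hq : 0 ≤ q) (hq1 : q < 1) {f G : ℝ → ℂ}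
    (h : FourierCorrespond q p f G) :
    normSqL2 f ≤ ENNReal.ofReal (1 + q) ^ 2 * normSqL2 G ∧
      normSqL2 G ≤ ENNReal.ofReal (1 - q)⁻¹ ^ 2 * normSqL2 f := by
  rw [h.normSqL2_eq]
  obtain ⟨φ, hf, hφ, hG, -, -⟩ := h
  have hGp := (memLp_comp_add_right hG p).const_mul (q : ℂ)
  have hF : MemLp (fun ξ => G ξ - q * G (ξ + p)) 2 volume := hG.sub hGp
  simp only [normSqL2, ← mul_pow]
  have hle1 : eLpNorm (fun ξ => G ξ - q * G (ξ + p)) 2 volume ≤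
      ENNReal.ofReal (1 + q) * eLpNorm G 2 volume := by
    refine (eLpNorm_sub_le hG.1 hGp.1 (by norm_num)).trans ?_
    rw [eLpNorm_const_mul_shift hq p hG, ENNReal.ofReal_add zero_le_one hq, ENNReal.ofReal_one,
      add_mul, one_mul]
  have hle2 : eLpNorm G 2 volume ≤
      eLpNorm (fun ξ => G ξ - q * G (ξ + p)) 2 volume + ENNReal.ofReal q * eLpNorm G 2 volume := by
    have := eLpNorm_add_le (p := 2) hF.1 hGp.1 (by norm_num)
    rw [eLpNorm_const_mul_shift hq p hG] at this
    convert this using 2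
    ext ξ
    simp
  refine ⟨by gcongr, ?_⟩
  gcongr
  -- Both norms are finite, so q‖G‖ can be absorbed on the left after passing to real numbers.
  have hx := hG.2.ne
  have hy := hF.2.ne
  generalize eLpNorm G 2 volume = x at *
  generalize eLpNorm (fun ξ => G ξ - q * G (ξ + p)) 2 volume = y at *
  lift x to ℝ≥0 using hx
  lift y to ℝ≥0 using hy
  have h3 := ENNReal.toReal_mono (by finiteness) hle2
  rw [ENNReal.toReal_add (by finiteness) (by finiteness), ENNReal.toReal_mul,
    ENNReal.toReal_ofReal hq] at h3
  simp only [ENNReal.coe_toReal] at h3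
  rw [← ENNReal.ofReal_coe_nnreal, ← ENNReal.ofReal_coe_nnreal, ← ENNReal.ofReal_mul
    (inv_nonneg.2 (sub_nonneg.2 hq1.le))]
  refine ENNReal.ofReal_le_ofReal ?_
  rw [inv_mul_eq_div, le_div_iff₀ (sub_pos.2 hq1)]
  linarith

theorem exists_fourierCorrespond_right (q p : ℝ) {G : ℝ → ℂ} (hG : MemLp G 2 volume) :
    ∃ f, FourierCorrespond q p f G := by
  have hφ := memLp_conj_sub_shift q p hG
  refine ⟨(𝓕⁻ (hφ.toLp _) : Lp ℂ 2 (volume : Measure ℝ)), _, Lp.memLp _, hφ, hG, ?_, ae_eq_rfl⟩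
  rw [Lp.toLp_coeFn, FourierTransform.fourier_fourierInv_eq]

/-- With S the isometric translation by p, the operator 1 - qS is invertible by the Neumann series,
as ‖qS‖ < 1. -/
theorem exists_memLp_sub_shift_ae_eq {q : ℝ} (hq : 0 ≤ q) (hq1 : q < 1) (p : ℝ) {F : ℝ → ℂ}
    (hF : MemLp F 2 volume) :
    ∃ G, MemLp G 2 volume ∧ F =ᵐ[volume] fun ξ => G ξ - q * G (ξ + p) := by
  have hmp := measurePreserving_add_right (volume : Measure ℝ) p
  set S : Lp ℂ 2 (volume : Measure ℝ) →L[ℂ] Lp ℂ 2 (volume : Measure ℝ) :=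
    (Lp.compMeasurePreservingₗᵢ ℂ (fun x : ℝ => x + p) hmp).toContinuousLinearMap with hS
  have hS1 : ‖S‖ ≤ 1 := LinearIsometry.norm_toContinuousLinearMap_le _
  have hlt : ‖(q : ℂ) • S‖ < 1 := by
    rw [norm_smul, Complex.norm_real, Real.norm_of_nonneg hq]
    nlinarith [norm_nonneg S]
  obtain ⟨u, hu⟩ := isUnit_one_sub_of_norm_lt_one hlt
  set g : Lp ℂ 2 (volume : Measure ℝ) :=
    (↑u⁻¹ : Lp ℂ 2 (volume : Measure ℝ) →L[ℂ] Lp ℂ 2 (volume : Measure ℝ)) (hF.toLp F)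
  have hg : g - (q : ℂ) • S g = hF.toLp F := by
    have h1 : (1 - (q : ℂ) • S) g = hF.toLp F := by
      rw [← hu]
      exact congrArg (fun T : Lp ℂ 2 (volume : Measure ℝ) →L[ℂ] Lp ℂ 2 (volume : Measure ℝ) =>
        T (hF.toLp F)) u.mul_inv
    exact h1
  refine ⟨g, Lp.memLp g, ?_⟩
  have h2 : (S g : ℝ → ℂ) =ᵐ[volume] fun x => g (x + p) := Lp.coeFn_compMeasurePreserving g hmp
  filter_upwards [hF.coeFn_toLp, h2, Lp.coeFn_sub g ((q : ℂ) • S g),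
    Lp.coeFn_smul (q : ℂ) (S g)] with ξ e1 e2 e3 e4
  rw [← e1, ← hg, e3, Pi.sub_apply, e4, Pi.smul_apply, e2, smul_eq_mul]

theorem exists_fourierCorrespond_left {q : ℝ} (hq : 0 ≤ q) (hq1 : q < 1) (p : ℝ) {f : ℝ → ℂ}
    (hf : MemLp f 2 volume) : ∃ G, FourierCorrespond q p f G := by
  set φ : Lp ℂ 2 (volume : Measure ℝ) := 𝓕 (hf.toLp f) with hφ
  obtain ⟨G, hG, h⟩ := exists_memLp_sub_shift_ae_eq hq hq1 p (Lp.memLp φ).star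
  refine ⟨G, φ, hf, Lp.memLp φ, hG, by rw [Lp.toLp_coeFn], ?_⟩
  filter_upwards [h] with ξ hξ
  rw [← hξ]
  simp

/-- The outer weight does not depend on k and leaves the inner sum as a common factor; it lies
between 1 and e^{-2πwp} on (0, p], which gives this bound and `shiftEnergy_le`. -/
theorem tsum_lintegral_unweightedTerm_le {w : ℝ} (hw : w < 0) (α : ℝ) (G : ℝ → ℂ) :
    ∑' m : ℤ, ∫⁻ t in Ioc 0 (1 / α), ‖∑' k, unweightedTerm a b w (1 / α) G m k t‖ₑ ^ 2 ≤
      shiftEnergy a b w α G := by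
  refine ENNReal.tsum_le_tsum fun m => setLIntegral_mono' measurableSet_Ioc fun t ht => ?_
  simp_rw [unweightedTerm_eq, tsum_mul_left, enorm_mul]
  gcongr
  refine mul_le_of_le_one_left' ?_
  rw [← ofReal_norm, Complex.norm_real, Real.norm_of_nonneg (Real.exp_pos _).le]
  refine ENNReal.ofReal_le_one.2 (Real.exp_le_one_iff.2 ?_)
  exact mul_nonpos_of_nonpos_of_nonneg
    (mul_nonpos_of_nonneg_of_nonpos Real.two_pi_pos.le hw.le) ht.1.le

theorem shiftEnergy_le {w : ℝ} (hw : w < 0) (α : ℝ) (G : ℝ → ℂ) :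
    shiftEnergy a b w α G ≤ ENNReal.ofReal (Real.exp (-2 * Real.pi * w * (1 / α))) ^ 2 *
      ∑' m : ℤ, ∫⁻ t in Ioc 0 (1 / α), ‖∑' k, unweightedTerm a b w (1 / α) G m k t‖ₑ ^ 2 := by
  rw [shiftEnergy, ← ENNReal.tsum_mul_left]
  refine ENNReal.tsum_le_tsum fun m => ?_
  rw [← lintegral_const_mul' _ _ (by finiteness)]
  refine setLIntegral_mono' measurableSet_Ioc fun t ht => ?_
  simp_rw [shiftTerm_eq, tsum_mul_left, enorm_mul, ← mul_pow]
  gcongr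
  rw [← ofReal_norm, Complex.norm_real, Real.norm_of_nonneg (Real.exp_pos _).le]
  refine ENNReal.ofReal_le_ofReal (Real.exp_le_exp.2 ?_)
  refine mul_le_mul_of_nonneg_left ht.2 ?_
  nlinarith [mul_neg_of_pos_of_neg Real.two_pi_pos hw]

/-- The frame sum of `f` and the shift energy of the corresponding `G` are comparable, and so are
the norms of `f` and `G`. -/
theorem exists_forall_fourierCorrespond_le {w α : ℝ} (ha : Summable fun k => ‖a k‖) (hw : w < 0)
    (hα : 0 < α) : ∃ M : ℝ≥0, 0 < M ∧ ∀ f G : ℝ → ℂ,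
      FourierCorrespond (Real.exp (2 * Real.pi * w * (1 / α))) (1 / α) f G →
      (∑' mn : ℤ × ℤ, ‖innerL2 f (gaborSystem (window a b w) α 1 mn)‖ₑ ^ 2 ≤
          M * shiftEnergy a b w α G ∧
        shiftEnergy a b w α G ≤
          M * ∑' mn : ℤ × ℤ, ‖innerL2 f (gaborSystem (window a b w) α 1 mn)‖ₑ ^ 2) ∧
      (normSqL2 f ≤ M * normSqL2 G ∧ normSqL2 G ≤ M * normSqL2 f) := by
  have hp : 0 < 1 / α := by positivity
  set q := Real.exp (2 * Real.pi * w * (1 / α))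
  have hq : 0 ≤ q := (Real.exp_pos _).le
  have hq1 : q < 1 := Real.exp_lt_one_iff.2
    (mul_neg_of_neg_of_pos (mul_neg_of_pos_of_neg Real.two_pi_pos hw) hp)
  have hK : 0 < (2 * Real.pi) ^ 2 * (1 / α) := by positivity
  set K : ℝ≥0 := ((2 * Real.pi) ^ 2 * (1 / α)).toNNReal with hKdef
  have hK0 : K ≠ 0 := (Real.toNNReal_pos.2 hK).ne'
  set c : ℝ≥0 := (Real.exp (-2 * Real.pi * w * (1 / α))).toNNReal ^ 2
  set d : ℝ≥0 := (1 + q).toNNReal ^ 2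
  set e : ℝ≥0 := ((1 - q)⁻¹).toNNReal ^ 2
  have hc : ENNReal.ofReal (Real.exp (-2 * Real.pi * w * (1 / α))) ^ 2 = (c : ℝ≥0∞) :=
    (ENNReal.coe_pow _ _).symm
  have hd : ENNReal.ofReal (1 + q) ^ 2 = (d : ℝ≥0∞) := (ENNReal.coe_pow _ _).symm
  have he : ENNReal.ofReal (1 - q)⁻¹ ^ 2 = (e : ℝ≥0∞) := (ENNReal.coe_pow _ _).symm
  -- One summand per estimate: K bounds the frame sum by the energy, c K⁻¹ the energy by the frame
  -- sum, d the norm of f by that of G, and e the converse.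
  refine ⟨K + c * K⁻¹ + d + e, by positivity, fun f G h => ⟨?_, ?_⟩⟩
  · obtain ⟨φ, hf, hφ, hG, h1, h2⟩ := h
    rw [tsum_enorm_innerL2_gaborSystem_sq ha hw hα hf hφ hG h1 h2]
    change (K : ℝ≥0∞) * _ ≤ _ ∧ _ ≤ _ * ((K : ℝ≥0∞) * _)
    constructor
    · refine (mul_le_mul_right (tsum_lintegral_unweightedTerm_le hw α G) _).trans
        (mul_le_mul_left ?_ _)
      exact_mod_cast (by rw [add_assoc, add_assoc]; exact le_self_add :
        K ≤ K + c * K⁻¹ + d + e)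
    · refine (shiftEnergy_le hw α G).trans ?_
      rw [← mul_assoc, hc]
      refine mul_le_mul_left ?_ _
      have : c ≤ (K + c * K⁻¹ + d + e) * K := by
        calc c = c * K⁻¹ * K := by field_simp
          _ ≤ _ := by
            gcongr
            rw [add_assoc, add_assoc, add_left_comm]
            exact le_self_add
      exact_mod_cast this
  · obtain ⟨h1, h2⟩ := h.normSqL2_le hq hq1
    rw [hd] at h1
    rw [he] at h2
    refine ⟨h1.trans (mul_le_mul_left ?_ _), h2.trans (mul_le_mul_left ?_ _)⟩
    · exact_mod_cast (le_add_right le_add_self : d ≤ K + c * K⁻¹ + d + e)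
    · exact_mod_cast (le_add_self : e ≤ K + c * K⁻¹ + d + e)

end Correspondence

end GaborCauchy

end

/-! ### Transfer of the two-sided inequalities -/

open GaborCauchy in
theorem mainTheorem3 (a : ℕ → ℂ) (b : ℕ → ℝ) (w α : ℝ)
    (ha : Summable fun k => ‖a k‖) (hb : ∀ k, 0 ≤ b k) (hw : w < 0) (hα : 0 < α) :
    (∀ G : ℝ → ℂ, MeasureTheory.MemLp G 2 MeasureTheory.volume → ∀ m : ℤ,
      ∀ᵐ t ∂(MeasureTheory.volume.restrict (Set.Ioc 0 (1 / α))),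
        Summable fun k => GaborCauchy.shiftTerm a b w α G m k t) ∧
    (GaborCauchy.IsGaborFrame (GaborCauchy.window a b w) α 1 ↔
      GaborCauchy.AsympOn {G : ℝ → ℂ | MeasureTheory.MemLp G 2 MeasureTheory.volume}
        (GaborCauchy.shiftEnergy a b w α) GaborCauchy.normSqL2) := by
  refine ⟨fun G hG m => ae_summable_shiftTerm ha hw hα hG m, ?_⟩
  obtain ⟨M, hM, hcorr⟩ := exists_forall_fourierCorrespond_le (b := b) ha hw hα
  have hq1 : Real.exp (2 * Real.pi * w * (1 / α)) < 1 := Real.exp_lt_one_iff.2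
    (mul_neg_of_neg_of_pos (mul_neg_of_pos_of_neg Real.two_pi_pos hw) (by positivity))
  constructor
  · rintro ⟨-, A, B, hA, -, hAB⟩
    -- One factor M exchanges the frame sum and the energy, the other exchanges the norms of f and
    -- G; every G has a partner f by inverting the Fourier transform.
    refine ⟨⟨M * B * M, fun G hG => ?_⟩, ⟨M * A⁻¹ * M, fun G hG => ?_⟩⟩ <;>
    obtain ⟨f, hfG⟩ := exists_fourierCorrespond_right
      (Real.exp (2 * Real.pi * w * (1 / α))) (1 / α) hG <;>
    obtain ⟨⟨h1, h2⟩, h3, h4⟩ := hcorr f G hfG <;>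
    obtain ⟨hfA, hfB⟩ := hAB f hfG.choose_spec.choose <;>
    push_cast <;> simp only [mul_assoc]
    · exact h2.trans (by gcongr; exact hfB.trans (by gcongr))
    · refine h4.trans (mul_le_mul_right ?_ _)
      rw [ENNReal.coe_inv hA.ne']
      refine (ENNReal.mul_le_iff_le_inv (by simpa using hA.ne') ENNReal.coe_ne_top).1 ?_
      exact hfA.trans h1
  · rintro ⟨⟨C₁, hC₁⟩, C₂, hC₂⟩
    -- C₁ and C₂ may vanish; adding 1 makes the frame bounds strictly positive.
    refine ⟨memLp_window ha hw, (M * (C₂ + 1) * M)⁻¹, M * (C₁ + 1) * M, by positivity,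
      by positivity, fun f hf => ?_⟩
    obtain ⟨G, hfG⟩ := exists_fourierCorrespond_left (Real.exp_pos _).le hq1 (1 / α) hf
    obtain ⟨⟨h1, h2⟩, h3, h4⟩ := hcorr f G hfG
    have hG : MemLp G 2 volume := hfG.choose_spec.choose_spec.choose_spec.1
    have h5 : shiftEnergy a b w α G ≤ (C₁ + 1 : ℝ≥0) * normSqL2 G :=
      (hC₁ G hG).trans (by gcongr; exact le_self_add)
    have h6 : normSqL2 G ≤ (C₂ + 1 : ℝ≥0) * shiftEnergy a b w α G :=
      (hC₂ G hG).trans (by gcongr; exact le_self_add)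
    constructor
    · have hne : M * (C₂ + 1) * M ≠ 0 := by positivity
      rw [ENNReal.coe_inv hne]
      refine (ENNReal.inv_mul_le_iff (by simpa using hne) ENNReal.coe_ne_top).2 ?_
      rw [ENNReal.coe_mul, ENNReal.coe_mul, mul_assoc, mul_assoc]
      exact h3.trans (by gcongr; exact h6.trans (by gcongr))
    · rw [ENNReal.coe_mul, ENNReal.coe_mul, mul_assoc, mul_assoc]
      exact h1.trans (by gcongr; exact h5.trans (by gcongr))
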